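/- **Setting.** A simplicial complex $K$ over a finite set is a family of subsets closed under inclusion and containing $\emptyset$; $S_j(K)$ is the set of its $j$-faces (faces with $j+1$ elements), and $F\in\partial\bar F$ means that $F\subset\bar F$ are faces with $|\bar F|=|F|+1$. The cochain space $C^j(K)$ consists of the real functions $f$ on ordered $j$-faces that change by the sign of a permutation of the vertices. Given a positive weight $w$ on the faces, $C^j(K)$ has the inner product $\langle f,g\rangle=\sum_{F\in S_j(K)}w(F)f([F])g([F])$. The coboundary map $\delta_{j}:C^{j}(K)\to C^{j+1}(K)$ is $(\delta_{j}f)([v_0,\dots,v_{j+1}])=\sum_l(-1)^lf([v_0,\dots,\hat v_l,\dots,v_{j+1}])$, and the $i$-down Laplacian is $\mathcal L_i^{\mathrm{down}}(K)=\delta_{i-1}\delta_{i-1}^*$. An incidence-signed complex $(K,s)$ is a complex with a function $s:K\times K\to\{-1,0,1\}$ such that $s(F,\bar F)=\pm1$ if $F\in\partial\bar F$ and $s(F,\bar F)=0$ otherwise; its coboundary $\delta^s$ is $\delta$ with the $l$-th term multiplied by $s(\{v_0,\dots,\hat v_l,\dots,v_{j+1}\},\{v_0,\dots,v_{j+1}\})$,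 and $\mathcal L_i^{\mathrm{down}}(K,s)=\delta^s_{i-1}(\delta^s_{i-1})^*$. $\operatorname{Spec}$ is the multiset of eigenvalues, with multiplicity. A $2$-fold covering $\phi:K\to M$ is a map $V(K)\to V(M)$ on the vertices such that: $K$ is connected; $\phi$ maps faces to faces; for each $G\in M$ the faces $F$ of $K$ with $\phi(F)=G$ are pairwise disjoint, are mapped bijectively onto $G$, and have union $\phi^{-1}(G)$; if $G\in\partial\bar G$ in $M$ and $\phi(F)=G$, then there is $\bar F\in K$ with $F\in\partial\bar F$ and $\phi(\bar F)=\bar G$; and over each nonempty face of $M$ there are exactly two faces of $K$. The incidence graph $B_{i-1}(K)$ has vertex set $S_{i-1}(K)\cup S_i(K)$ and edges $\{F,\bar F\}$ for $F\in\partial\bar F$. A permutation assignment $\psi$ in $\mathbb S_2$ on a graph $B$ gives each arc $(u,v)$ a permutation $\psi(u,v)\in\mathbb S_2$ with $\psi(v,u)=\psi(u,v)^{-1}$; the derived graph $B^\psi$ has vertex set $V(B)\times\{1,2\}$, with $(u,a)$ and $(v,b)$ adjacent iff $u,v$ are adjacent in $B$ and $a=\psi(u,v)(b)$. **Theorem.**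 Let $i\ge1$, let $\phi:K\to M$ be a $2$-fold covering, and let $w_K,w_M$ be positive weights with $w_K(F)=w_M(\phi(F))$ for all $F\in S_{i-1}(K)\cup S_i(K)$. Then: 1. There are a permutation assignment $\psi$ in $\mathbb S_2$ on $B_{i-1}(M)$ and a graph isomorphism $\eta:B_{i-1}(M)^\psi\to B_{i-1}(K)$ with $\phi(\eta(G,a))=G$ for all $G\in S_{i-1}(M)\cup S_i(M)$ and $a\in\{1,2\}$. 2. For every such $\psi$ and $\eta$ there is an incidence signing $s$ of $M$ with $s(F,\bar F)=\operatorname{sgn}\psi(F,\bar F)$ for all $(F,\bar F)\in S_{i-1}(M)\times S_i(M)$ with $F\in\partial\bar F$, and for every such $s$, as a multiset union (multiplicities add), $$\operatorname{Spec}\mathcal L_i^{\mathrm{down}}(K)=\operatorname{Spec}\mathcal L_i^{\mathrm{down}}(M)\cup\operatorname{Spec}\mathcal L_i^{\mathrm{down}}(M,s).$$ -/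

import Mathlib

namespace CoverLap

/-! ### Simplicial complexes -/

/-- An abstract simplicial complex over `V`: a family of finite subsets of `V` that is closed under
inclusion and contains the empty simplex. -/
structure SimpComplex (V : Type*) where
  faces : Set (Finset V)
  empty_mem : ∅ ∈ faces
  down_closed : ∀ F ∈ faces, ∀ E ⊆ F, E ∈ faces

namespace SimpComplex

variable {V : Type*} (K : SimpComplex V)

/-- The simplices of `K`, of all dimensions. -/
abbrev Simplex : Type _ := {F : Finset V // F ∈ K.faces}

/-- The simplices with exactly `n` vertices, that is, the set `S_{n-1}(K)` of the
`(n-1)`-dimensional faces; `n = 0` gives the empty simplex. -/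
abbrev Face (n : ℕ) : Type _ := {F : K.Simplex // F.1.card = n}

/-- The vertices of `K`. -/
abbrev Vertex : Type _ := {v : V // {v} ∈ K.faces}

/-- The graph formed by the vertices and the edges of `K`. -/
def graph [DecidableEq V] : SimpleGraph K.Vertex where
  Adj u v := u ≠ v ∧ ({u.1, v.1} : Finset V) ∈ K.faces
  symm := ⟨fun u v h => ⟨h.1.symm, by rw [Finset.pair_comm]; exact h.2⟩⟩
  loopless := ⟨fun _ h => h.1 rfl⟩

end SimpComplex

/-- `F ∈ ∂ F'`: the simplex `F` is a codimension one face of `F'`. -/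
def IsFacetOf {V : Type*} (F F' : Finset V) : Prop := F ⊆ F' ∧ F'.card = F.card + 1

/-- A weight function on the simplices of `K`, with positive values. -/
structure Weight {V : Type*} (K : SimpComplex V) where
  val : K.Simplex → ℝ
  pos : ∀ F, 0 < val F

/-- An incidence signing of `K`: a function `s : K × K → {-1, 0, 1}` which is `±1` exactly on the
incidences of `K`. The pair `(K, s)` is an incidence-signed complex. -/
structure IncidenceSign {V : Type*} (K : SimpComplex V) where
  val : K.Simplex → K.Simplex → ℤ
  of_incident : ∀ F F', IsFacetOf F.1 F'.1 → val F F' = 1 ∨ val F F' = -1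
  of_not_incident : ∀ F F', ¬ IsFacetOf F.1 F'.1 → val F F' = 0

/-! ### Ordered simplices and cochains -/

section Cochains

variable {V : Type*} (K : SimpComplex V)

/-- The orderings `(v_0, …, v_{n-1})` of the simplices of `K` with `n` vertices. -/
abbrev OrdFace (n : ℕ) : Type _ := {v : Fin n ↪ V // Finset.univ.map v ∈ K.faces}

variable {K}

namespace OrdFace

/-- The simplex underlying an ordered simplex. -/
def simplex {n : ℕ} (v : OrdFace K n) : K.Simplex := ⟨Finset.univ.map v.1, v.2⟩

/-- Reordering the vertices: `(v_{σ 0}, …, v_{σ (n-1)})`. -/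
def perm {n : ℕ} (v : OrdFace K n) (σ : Equiv.Perm (Fin n)) : OrdFace K n :=
  ⟨σ.toEmbedding.trans v.1, by
    have h : Finset.univ.map (σ.toEmbedding.trans v.1) = Finset.univ.map v.1 := by
      rw [← Finset.map_map, Finset.map_univ_equiv]
    rw [h]; exact v.2⟩

/-- Omitting a vertex: `(v_0, …, v̂_j, …, v_n)`. -/
def del {n : ℕ} (v : OrdFace K (n + 1)) (j : Fin (n + 1)) : OrdFace K n :=
  ⟨(Fin.succAboveEmb j).trans v.1, by
    refine K.down_closed _ v.2 _ ?_
    rw [← Finset.map_map]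
    exact Finset.map_subset_map.2 (Finset.subset_univ _)⟩

@[simp] lemma simplex_perm {n : ℕ} (v : OrdFace K n) (σ : Equiv.Perm (Fin n)) :
    (v.perm σ).simplex = v.simplex := by
  apply Subtype.ext
  change Finset.univ.map (σ.toEmbedding.trans v.1) = Finset.univ.map v.1
  rw [← Finset.map_map, Finset.map_univ_equiv]

/-- Two orderings of the same simplex differ by a permutation. -/
lemma exists_perm {n : ℕ} {u v : OrdFace K n} (h : u.simplex = v.simplex) :
    ∃ σ : Equiv.Perm (Fin n), u = v.perm σ := by
  have hs : Finset.univ.map u.1 = Finset.univ.map v.1 := congrArg Subtype.val h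
  have hm : ∀ a, ∃ b, v.1 b = u.1 a := by
    intro a
    have : u.1 a ∈ Finset.univ.map v.1 := by
      rw [← hs]; exact Finset.mem_map_of_mem _ (Finset.mem_univ _)
    simpa using this
  choose g hg using hm
  have hinj : Function.Injective g := by
    intro a b hab
    apply u.1.injective
    rw [← hg a, ← hg b, hab]
  refine ⟨Equiv.ofBijective g (Finite.injective_iff_bijective.1 hinj), ?_⟩
  apply Subtype.ext
  ext a
  exact (hg a).symm

end OrdFace

/-- Some ordering of a simplex with `n` vertices exists. -/
lemma exists_ordering {n : ℕ} (F : K.Face n) : ∃ v : OrdFace K n, v.simplex = F.1 := by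
  obtain ⟨⟨F, hF⟩, rfl⟩ := F
  have h : Finset.univ.map (F.equivFin.symm.toEmbedding.trans (Function.Embedding.subtype _)) = F := by
    rw [← Finset.map_map, Finset.map_univ_equiv]
    ext x; simp
  exact ⟨⟨F.equivFin.symm.toEmbedding.trans (Function.Embedding.subtype _), h.symm ▸ hF⟩,
    Subtype.ext h⟩

/-- A reference ordering `[F]` of the simplex `F`. -/
noncomputable def ordering {n : ℕ} (F : K.Face n) : OrdFace K n := (exists_ordering F).choose

lemma simplex_ordering {n : ℕ} (F : K.Face n) : (ordering F).simplex = F.1 :=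
  (exists_ordering F).choose_spec

/-- The alternating functions on ordered simplices with `n` vertices. These are the linear forms on
the chain group `C_{n-1}(K, ℝ)`: ordered simplices with the same orientation have the same
value, and opposite orientations have opposite values. -/
def cochains (K : SimpComplex V) (n : ℕ) : Submodule ℝ (OrdFace K n → ℝ) where
  carrier := {f | ∀ (v : OrdFace K n) (σ : Equiv.Perm (Fin n)),
    f (v.perm σ) = ((Equiv.Perm.sign σ : ℤ) : ℝ) * f v}
  add_mem' := by
    intro f g hf hg v σ
    simp only [Pi.add_apply, hf v σ, hg v σ]; ring
  zero_mem' := by intro v σ; simp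
  smul_mem' := by
    intro c f hf v σ
    simp only [Pi.smul_apply, smul_eq_mul, hf v σ]; ring

/-- The cochain group `C^{n-1}(K, ℝ)`, as a type that will carry the inner product
given by the weight `w`. -/
def Cochain (K : SimpComplex V) (_w : Weight K) (n : ℕ) : Type _ := cochains K n

noncomputable instance (w : Weight K) (n : ℕ) : AddCommGroup (Cochain K w n) :=
  inferInstanceAs (AddCommGroup (cochains K n))

noncomputable instance (w : Weight K) (n : ℕ) : Module ℝ (Cochain K w n) :=
  inferInstanceAs (Module ℝ (cochains K n))

noncomputable instance [Fintype V] (n : ℕ) : Fintype (OrdFace K n) := Fintype.ofFinite _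

noncomputable instance [Fintype V] (n : ℕ) : Fintype (K.Face n) := Fintype.ofFinite _

instance [Fintype V] (w : Weight K) (n : ℕ) : FiniteDimensional ℝ (Cochain K w n) :=
  inferInstanceAs (FiniteDimensional ℝ (cochains K n))

/-- The value of a cochain at an ordered simplex. -/
def Cochain.eval {w : Weight K} {n : ℕ} (f : Cochain K w n) (v : OrdFace K n) : ℝ := f.1 v

/-- The cochain given by an alternating function. -/
def Cochain.mk {w : Weight K} {n : ℕ} (f : OrdFace K n → ℝ)
    (hf : ∀ (v : OrdFace K n) (σ : Equiv.Perm (Fin n)),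
      f (v.perm σ) = ((Equiv.Perm.sign σ : ℤ) : ℝ) * f v) : Cochain K w n := ⟨f, hf⟩

namespace Cochain

variable {w : Weight K} {n : ℕ}

lemma ext_eval {f g : Cochain K w n} (h : ∀ v, f.eval v = g.eval v) : f = g :=
  Subtype.ext (funext h)

lemma eval_perm (f : Cochain K w n) (v : OrdFace K n) (σ : Equiv.Perm (Fin n)) :
    f.eval (v.perm σ) = ((Equiv.Perm.sign σ : ℤ) : ℝ) * f.eval v := f.2 v σ

@[simp] lemma eval_mk (f : OrdFace K n → ℝ) (hf) (v : OrdFace K n) :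
    (Cochain.mk f hf : Cochain K w n).eval v = f v := rfl

@[simp] lemma eval_add (f g : Cochain K w n) (v : OrdFace K n) :
    (f + g).eval v = f.eval v + g.eval v := rfl

@[simp] lemma eval_smul (c : ℝ) (f : Cochain K w n) (v : OrdFace K n) :
    (c • f).eval v = c * f.eval v := rfl

@[simp] lemma eval_zero (v : OrdFace K n) : (0 : Cochain K w n).eval v = 0 := rfl

/-- The product of two cochains does not depend on the ordering of the simplex. -/
lemma eval_mul_eval_eq (f g : Cochain K w n) {u v : OrdFace K n} (h : u.simplex = v.simplex) :
    f.eval u * g.eval u = f.eval v * g.eval v := by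
  obtain ⟨σ, rfl⟩ := OrdFace.exists_perm h
  rw [eval_perm, eval_perm]
  rcases Int.units_eq_one_or (Equiv.Perm.sign σ) with h | h <;> simp [h]

/-- The weighted inner product `∑_F w(F) f([F]) g([F])`. -/
noncomputable instance innerCore [Fintype V] (w : Weight K) (n : ℕ) :
    InnerProductSpace.Core ℝ (Cochain K w n) where
  inner f g := ∑ F : K.Face n, w.val F.1 * f.eval (ordering F) * g.eval (ordering F)
  conj_inner_symm f g := by
    simp only [conj_trivial]
    exact Finset.sum_congr rfl fun F _ => by ring
  re_inner_nonneg f := by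
    simp only [RCLike.re_to_real]
    refine Finset.sum_nonneg fun F _ => ?_
    rw [mul_assoc]
    exact mul_nonneg (w.pos _).le (mul_self_nonneg _)
  add_left f g h := by
    simp only [eval_add]
    rw [← Finset.sum_add_distrib]
    exact Finset.sum_congr rfl fun F _ => by ring
  smul_left f g c := by
    simp only [eval_smul, conj_trivial]
    rw [Finset.mul_sum]
    exact Finset.sum_congr rfl fun F _ => by ring
  definite f hf := by
    have h0 : ∀ F ∈ (Finset.univ : Finset (K.Face n)),
        0 ≤ w.val F.1 * f.eval (ordering F) * f.eval (ordering F) := by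
      intro F _
      rw [mul_assoc]
      exact mul_nonneg (w.pos _).le (mul_self_nonneg _)
    have h1 := (Finset.sum_eq_zero_iff_of_nonneg h0).1 hf
    apply ext_eval
    intro v
    have hc : v.simplex.1.card = n := by simp [OrdFace.simplex]
    have h2 := h1 ⟨v.simplex, hc⟩ (Finset.mem_univ _)
    rw [mul_assoc] at h2
    rw [eval_mul_eval_eq f f (v := v) (simplex_ordering _)] at h2
    simpa [(w.pos _).ne'] using h2

noncomputable instance [Fintype V] (w : Weight K) (n : ℕ) : NormedAddCommGroup (Cochain K w n) :=
  (innerCore w n).toNormedAddCommGroup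

noncomputable instance [Fintype V] (w : Weight K) (n : ℕ) : InnerProductSpace ℝ (Cochain K w n) :=
  InnerProductSpace.ofCore (innerCore w n).toCore

end Cochain

/-- Deleting the entry `j` after a reordering `σ` is a reordering of the deletion of the entry
`σ j`, and the signs match. -/
lemma OrdFace.exists_del_perm {n : ℕ} (σ : Equiv.Perm (Fin (n + 1))) (j : Fin (n + 1)) :
    ∃ τ : Equiv.Perm (Fin n), (∀ v : OrdFace K (n + 1), (v.perm σ).del j = (v.del (σ j)).perm τ) ∧
      (-1 : ℤ) ^ (j : ℕ) * (Equiv.Perm.sign τ : ℤ) =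
        (Equiv.Perm.sign σ : ℤ) * (-1) ^ ((σ j : Fin (n + 1)) : ℕ) := by
  obtain ⟨⟨p, τ⟩, hρ⟩ : ∃ q : Fin (n + 1) × Equiv.Perm (Fin n),
      Equiv.Perm.decomposeFin.symm q = (σ j).cycleRange * σ * j.cycleRange⁻¹ :=
    ⟨_, Equiv.Perm.decomposeFin.symm_apply_apply _⟩
  have hp : p = 0 := by
    have h := congrArg (fun f : Equiv.Perm (Fin (n + 1)) => f 0) hρ
    simp only [Equiv.Perm.decomposeFin_symm_apply_zero, Equiv.Perm.mul_apply] at h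
    rw [h]
    change (σ j).cycleRange (σ (j.cycleRange.symm 0)) = 0
    rw [Fin.cycleRange_symm_zero, Fin.cycleRange_self]
  subst hp
  have key : ∀ a, σ (j.succAbove a) = (σ j).succAbove (τ a) := by
    intro a
    apply (σ j).cycleRange.injective
    rw [Fin.cycleRange_succAbove]
    have h := congrArg (fun f : Equiv.Perm (Fin (n + 1)) => f a.succ) hρ
    simp only [Equiv.Perm.decomposeFin_symm_apply_succ, Equiv.Perm.mul_apply, Equiv.swap_self,
      Equiv.refl_apply] at h
    rw [h]
    change _ = (σ j).cycleRange (σ (j.cycleRange.symm a.succ))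
    rw [Fin.cycleRange_symm_succ]
  refine ⟨τ, fun v => ?_, ?_⟩
  · apply Subtype.ext
    ext a
    exact congrArg v.1 (key a)
  · have h := congrArg (fun f => (Equiv.Perm.sign f : ℤ)) hρ
    simp only [Equiv.Perm.decomposeFin.symm_sign, if_true, one_mul, map_mul, Fin.sign_cycleRange,
      Equiv.Perm.sign_inv, Units.val_mul, Units.val_pow_eq_pow_val, Units.val_neg,
      Units.val_one] at h
    rw [h]
    have hj : (-1 : ℤ) ^ (j : ℕ) * (-1) ^ (j : ℕ) = 1 := by
      rw [← mul_pow]; simp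
    linear_combination (-1 : ℤ) ^ ((σ j : Fin (n + 1)) : ℕ) * (Equiv.Perm.sign σ : ℤ) * hj

/-- The coboundary map with coefficients `c`:
`(δ f)([v_0, …, v_n]) = ∑_j (-1)^j c({v_0, …, v̂_j, …, v_n}, {v_0, …, v_n}) f([v_0, …, v̂_j, …, v_n])`.
It is the conjugate of the boundary map whose incidences are multiplied by `c`. -/
noncomputable def coboundaryWith (w : Weight K) (c : K.Simplex → K.Simplex → ℝ) (n : ℕ) :
    Cochain K w n →ₗ[ℝ] Cochain K w (n + 1) where
  toFun f := Cochain.mk (fun v => ∑ j : Fin (n + 1),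
      (-1) ^ (j : ℕ) * c (v.del j).simplex v.simplex * f.eval (v.del j)) (by
    intro v σ
    rw [← Equiv.sum_comp σ (fun j : Fin (n + 1) =>
      (-1) ^ (j : ℕ) * c (v.del j).simplex v.simplex * f.eval (v.del j)), Finset.mul_sum]
    refine Finset.sum_congr rfl fun j _ => ?_
    obtain ⟨τ, h1, h2⟩ := OrdFace.exists_del_perm (K := K) σ j
    have h3 : (-1 : ℝ) ^ (j : ℕ) * ((Equiv.Perm.sign τ : ℤ) : ℝ) =
        ((Equiv.Perm.sign σ : ℤ) : ℝ) * (-1) ^ ((σ j : Fin (n + 1)) : ℕ) := by exact_mod_cast h2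
    rw [h1 v, OrdFace.simplex_perm, OrdFace.simplex_perm, Cochain.eval_perm]
    linear_combination c (v.del (σ j)).simplex v.simplex * f.eval (v.del (σ j)) * h3)
  map_add' f g := by
    apply Cochain.ext_eval
    intro v
    simp only [Cochain.eval_mk, Cochain.eval_add, mul_add, Finset.sum_add_distrib]
  map_smul' a f := by
    apply Cochain.ext_eval
    intro v
    simp only [Cochain.eval_mk, Cochain.eval_smul, RingHom.id_apply, Finset.mul_sum]
    exact Finset.sum_congr rfl fun j _ => by ring

/-- The coboundary map `δ_{n-1} : C^{n-1}(K) → C^n(K)`. -/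
noncomputable def coboundary (K : SimpComplex V) (w : Weight K) (n : ℕ) :
    Cochain K w n →ₗ[ℝ] Cochain K w (n + 1) :=
  coboundaryWith w (fun _ _ => 1) n

/-- The signed coboundary map `δ^s_{n-1} : C^{n-1}(K) → C^n(K)` of `(K, s)`. -/
noncomputable def signedCoboundary (K : SimpComplex V) (w : Weight K) (s : IncidenceSign K)
    (n : ℕ) : Cochain K w n →ₗ[ℝ] Cochain K w (n + 1) :=
  coboundaryWith w (fun F F' => (s.val F F' : ℝ)) n

variable [Fintype V]

/-- The `i`-down Laplace operator `δ_{i-1} δ_{i-1}^*` on `C^i(K)`, where the adjoint is taken with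
respect to the weighted inner products. -/
noncomputable def downLaplacian (K : SimpComplex V) (w : Weight K) (i : ℕ) :
    Cochain K w (i + 1) →ₗ[ℝ] Cochain K w (i + 1) :=
  coboundary K w i ∘ₗ LinearMap.adjoint (coboundary K w i)

/-- The `i`-down Laplace operator `δ^s_{i-1} (δ^s_{i-1})^*` of the incidence-signed complex
`(K, s)`. -/
noncomputable def signedDownLaplacian (K : SimpComplex V) (w : Weight K) (s : IncidenceSign K)
    (i : ℕ) : Cochain K w (i + 1) →ₗ[ℝ] Cochain K w (i + 1) :=
  signedCoboundary K w s i ∘ₗ LinearMap.adjoint (signedCoboundary K w s i)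

end Cochains

/-- The spectrum of an endomorphism of a finite-dimensional real space as a multiset: the roots of
the characteristic polynomial with multiplicity. (The Laplace operators above are self-adjoint, so
all their eigenvalues are real.) -/
noncomputable def spec {E : Type*} [AddCommGroup E] [Module ℝ E] [FiniteDimensional ℝ E]
    (L : E →ₗ[ℝ] E) : Multiset ℝ := L.charpoly.roots

/-! ### Coverings -/

section Coverings

variable {V W : Type*} [DecidableEq V] [DecidableEq W]

/-- The simplices of `K` lying over `G`. -/
def lifts (φ : V → W) (K : SimpComplex V) (G : Finset W) : Set (Finset V) :=
  {F | F ∈ K.faces ∧ F.image φ = G}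

/-- `φ` (of which only the values at vertices of `K` matter) is a covering map `K → M`:
`K` is connected, `φ` is simplicial, and for each simplex `G` of `M` the preimage of `G` is the
union of the simplices over `G`, which are pairwise disjoint and mapped bijectively onto `G`. -/
structure IsCovering (φ : V → W) (K : SimpComplex V) (M : SimpComplex W) : Prop where
  connected : K.graph.Connected
  simplicial : ∀ F ∈ K.faces, F.image φ ∈ M.faces
  preimage_eq : ∀ G ∈ M.faces, {v : V | {v} ∈ K.faces ∧ φ v ∈ G} = ⋃ F ∈ lifts φ K G, (F : Set V)
  pairwise_disjoint : ∀ G ∈ M.faces, (lifts φ K G).Pairwise Disjoint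
  bijOn : ∀ G ∈ M.faces, ∀ F ∈ lifts φ K G, Set.BijOn φ F G

/-- A strong covering: incidences `G ∈ ∂ G'` of `M` lift at every simplex over `G`. -/
structure IsStrongCovering (φ : V → W) (K : SimpComplex V) (M : SimpComplex W) : Prop
    extends IsCovering φ K M where
  lift_incidence : ∀ G ∈ M.faces, ∀ G' ∈ M.faces, IsFacetOf G G' →
    ∀ F ∈ lifts φ K G, ∃ F' ∈ lifts φ K G', IsFacetOf F F'

/-- A `k`-fold covering: a strong covering such that over each nonempty simplex of `M` there are
exactly `k` simplices of `K`. -/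
structure IsFoldCovering (k : ℕ) (φ : V → W) (K : SimpComplex V) (M : SimpComplex W) : Prop
    extends IsStrongCovering φ K M where
  degree : ∀ G ∈ M.faces, G.Nonempty → (lifts φ K G).ncard = k

end Coverings

/-! ### Incidence graphs and derived graphs -/

/-- The incidence graph `B_{n-1}(K)` on `S_{n-1}(K) ∪ S_n(K)`, where `F` and `F'` are adjacent when
`F ∈ ∂ F'`. -/
def incidenceGraph {V : Type*} (K : SimpComplex V) (n : ℕ) :
    SimpleGraph (K.Face n ⊕ K.Face (n + 1)) where
  Adj
    | .inl F, .inr F' => IsFacetOf F.1.1 F'.1.1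
    | .inr F', .inl F => IsFacetOf F.1.1 F'.1.1
    | _, _ => False
  symm := ⟨by rintro (F | F) (F' | F') h <;> exact h⟩
  loopless := ⟨by rintro (F | F) h <;> exact h⟩

/-- The simplex of `K` that a vertex of the incidence graph stands for. -/
def incidenceGraphSimplex {V : Type*} {K : SimpComplex V} {n : ℕ} :
    K.Face n ⊕ K.Face (n + 1) → K.Simplex :=
  Sum.elim (fun F => F.1) (fun F => F.1)

/-- An assignment of permutations of `k` letters to the arcs of a simple graph such that opposite
arcs have inverse permutations. -/
structure VoltageAssignment {X : Type*} (G : SimpleGraph X) (k : ℕ) where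
  val : G.Dart → Equiv.Perm (Fin k)
  val_symm : ∀ d, val d.symm = (val d)⁻¹

/-- The derived graph `G^ψ`: `(u, a)` and `(v, b)` are adjacent when `u` and `v` are
and `a = ψ(u, v)(b)`. -/
def derivedGraph {X : Type*} {G : SimpleGraph X} {k : ℕ} (ψ : VoltageAssignment G k) :
    SimpleGraph (X × Fin k) where
  Adj p q := ∃ h : G.Adj p.1 q.1, p.2 = ψ.val ⟨(p.1, q.1), h⟩ q.2
  symm := ⟨by
    rintro p q ⟨h, e⟩
    refine ⟨h.symm, ?_⟩
    have hs := ψ.val_symm ⟨(p.1, q.1), h⟩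
    change ψ.val ⟨(q.1, p.1), h.symm⟩ = _ at hs
    rw [hs, e]
    exact (Equiv.symm_apply_apply _ _).symm⟩
  loopless := ⟨fun p ⟨h, _⟩ => G.loopless.irrefl _ h⟩

/-- The isomorphism `η : B_{n-1}(M)^ψ ≅ B_{n-1}(K)` is compatible with the covering map `φ`:
`φ(η(G, a)) = G`. -/
def IsCompatible {V W : Type*} [DecidableEq W] (φ : V → W) {K : SimpComplex V} {M : SimpComplex W}
    {n k : ℕ} {ψ : VoltageAssignment (incidenceGraph M n) k}
    (η : derivedGraph ψ ≃g incidenceGraph K n) : Prop :=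
  ∀ (x : M.Face n ⊕ M.Face (n + 1)) (a : Fin k),
    (incidenceGraphSimplex (η (x, a))).1.image φ = (incidenceGraphSimplex x).1

/-- `s(F, F') = sgn ψ(F, F')` for all `F ∈ S_{n-1}(M)` and `F' ∈ S_n(M)` with `F ∈ ∂ F'`. -/
def IsSignOf {W : Type*} {M : SimpComplex W} {n k : ℕ} (s : IncidenceSign M)
    (ψ : VoltageAssignment (incidenceGraph M n) k) : Prop :=
  ∀ (F : M.Face n) (F' : M.Face (n + 1)) (h : (incidenceGraph M n).Adj (.inl F) (.inr F')),
    s.val F.1 F'.1 = (Equiv.Perm.sign (ψ.val ⟨(.inl F, .inr F'), h⟩) : ℤ)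

end CoverLap

open CoverLap

open CoverLap

/-! The permutation representation of the symmetric group on two letters is the sum of the trivial
and the sign character, and the spectrum splits accordingly. A covering induces a map of incidence
graphs. For `i ≥ 1` its fibres have two elements and edges lift uniquely: upwards by the strong
covering condition and disjointness of the faces over a simplex, downwards by injectivity on faces
(`IsStrongCovering.exists_node`, `IsCovering.node_unique`). Labelling the fibres arbitrarily and
recording how edges match the labels gives `ψ` and `η` (`exists_derivedGraph_iso`). Conversely, `η`
assigns to each face of `K` in the two dimensions a sheet `a`, with sign `ε(a) = ±1`. If faces over
`G` and `G'` on sheets `a` and `b` are incident, then `a = ψ(G, G')(b)`, so `ε(a) = ε(b) s(G, G')`.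
Hence the plain pullback intertwines `δ` on `M` with `δ` on `K`, while the pullback multiplied by
`ε` intertwines `δ^s` on `M` with `δ` on `K` (`coboundaryWith_pullback`). As the weights agree, both
pullbacks double the inner product, and their images are orthogonal (`inner_pullback`) and span
(`exists_pullback_add_pullback`). The adjoints are then intertwined too, so `δδ^*` on `K` is
conjugate to a block diagonal map and the characteristic polynomials multiply
(`spec_comp_adjoint_eq_add`). -/

namespace CoverLap

/-! ### Linear algebra: splitting `d d^*` along an orthogonal decomposition -/

section Linear

variable {E₀ E₁ F₀ F₁ : Type*}
  [NormedAddCommGroup E₀] [InnerProductSpace ℝ E₀] [FiniteDimensional ℝ E₀]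
  [NormedAddCommGroup E₁] [InnerProductSpace ℝ E₁] [FiniteDimensional ℝ E₁]
  [NormedAddCommGroup F₀] [InnerProductSpace ℝ F₀] [FiniteDimensional ℝ F₀]
  [NormedAddCommGroup F₁] [InnerProductSpace ℝ F₁] [FiniteDimensional ℝ F₁]

/-- If scaled isometries with jointly spanning orthogonal ranges intertwine `d` with `a`, then they
intertwine the adjoints. -/
lemma adjoint_intertwine {A₀ S₀ : F₀ →ₗ[ℝ] E₀} {A₁ S₁ : F₁ →ₗ[ℝ] E₁}
    {d : E₀ →ₗ[ℝ] E₁} {a b : F₀ →ₗ[ℝ] F₁} {c : ℝ}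
    (hA : ∀ f, d (A₀ f) = A₁ (a f)) (hS : ∀ f, d (S₀ f) = S₁ (b f))
    (hAA₀ : ∀ f g, inner ℝ (A₀ f) (A₀ g) = c * inner ℝ f g)
    (hSA₀ : ∀ f g, inner ℝ (S₀ f) (A₀ g) = 0)
    (hAA₁ : ∀ f g, inner ℝ (A₁ f) (A₁ g) = c * inner ℝ f g)
    (hSA₁ : ∀ f g, inner ℝ (S₁ f) (A₁ g) = 0)
    (hsurj : ∀ h, ∃ f g, A₀ f + S₀ g = h) (f : F₁) :
    LinearMap.adjoint d (A₁ f) = A₀ (LinearMap.adjoint a f) := by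
  -- Test against `A₀ x + S₀ y`: the `S` parts vanish on both sides, and both `A` parts reduce to
  -- `c` times the inner product of `a x` and `f`.
  refine ext_inner_left ℝ fun h => ?_
  obtain ⟨x, y, rfl⟩ := hsurj h
  rw [LinearMap.adjoint_inner_right, map_add, hA, hS, inner_add_left, inner_add_left, hAA₁, hSA₁,
    hAA₀, hSA₀, LinearMap.adjoint_inner_right]

/-- The spectrum of `d d^*` splits along an orthogonal decomposition that `d` respects. -/
lemma spec_comp_adjoint_eq_add {A₀ S₀ : F₀ →ₗ[ℝ] E₀} {A₁ S₁ : F₁ →ₗ[ℝ] E₁}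
    {d : E₀ →ₗ[ℝ] E₁} {a b : F₀ →ₗ[ℝ] F₁} {c : ℝ} (hc : c ≠ 0)
    (hA : ∀ f, d (A₀ f) = A₁ (a f)) (hS : ∀ f, d (S₀ f) = S₁ (b f))
    (hAA₀ : ∀ f g, inner ℝ (A₀ f) (A₀ g) = c * inner ℝ f g)
    (hSA₀ : ∀ f g, inner ℝ (S₀ f) (A₀ g) = 0)
    (hSS₀ : ∀ f g, inner ℝ (S₀ f) (S₀ g) = c * inner ℝ f g)
    (hAA₁ : ∀ f g, inner ℝ (A₁ f) (A₁ g) = c * inner ℝ f g)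
    (hSA₁ : ∀ f g, inner ℝ (S₁ f) (A₁ g) = 0)
    (hSS₁ : ∀ f g, inner ℝ (S₁ f) (S₁ g) = c * inner ℝ f g)
    (hsurj₀ : ∀ h, ∃ f g, A₀ f + S₀ g = h) (hsurj₁ : ∀ h, ∃ f g, A₁ f + S₁ g = h) :
    spec (d ∘ₗ LinearMap.adjoint d) =
      spec (a ∘ₗ LinearMap.adjoint a) + spec (b ∘ₗ LinearMap.adjoint b) := by
  have hA' := adjoint_intertwine hA hS hAA₀ hSA₀ hAA₁ hSA₁ hsurj₀
  -- The hypotheses are symmetric in `A` and `S`, so the same lemma serves with the roles exchanged.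
  have hS' := adjoint_intertwine hS hA hSS₀ (fun f g => by rw [real_inner_comm, hSA₀])
    hSS₁ (fun f g => by rw [real_inner_comm, hSA₁])
    (fun h => by
      obtain ⟨f, g, e⟩ := hsurj₀ h
      exact ⟨g, f, by rw [add_comm, e]⟩)
  -- Pairing a relation `A₁ f + S₁ g = 0` with each summand isolates `c` times a squared norm.
  have hinj : Function.Injective (A₁.coprod S₁) := by
    rw [← LinearMap.ker_eq_bot, LinearMap.ker_eq_bot']
    rintro ⟨f, g⟩ h
    rw [LinearMap.coprod_apply] at h
    dsimp only at h
    have h1 : inner ℝ (A₁ f + S₁ g) (A₁ f) = 0 := by rw [h, inner_zero_left]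
    have h2 : inner ℝ (S₁ g) (A₁ f + S₁ g) = 0 := by rw [h, inner_zero_right]
    rw [inner_add_left, hAA₁, hSA₁, add_zero] at h1
    rw [inner_add_right, hSS₁, hSA₁, zero_add] at h2
    rw [mul_eq_zero, or_iff_right hc, inner_self_eq_zero] at h1 h2
    rw [h1, h2]; rfl
  have hsurj : Function.Surjective (A₁.coprod S₁) := fun h => by
    obtain ⟨f, g, e⟩ := hsurj₁ h
    exact ⟨(f, g), e⟩
  let e : (F₁ × F₁) ≃ₗ[ℝ] E₁ := LinearEquiv.ofBijective _ ⟨hinj, hsurj⟩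
  have hconj : d ∘ₗ LinearMap.adjoint d =
      e.conj ((a ∘ₗ LinearMap.adjoint a).prodMap (b ∘ₗ LinearMap.adjoint b)) := by
    rw [LinearEquiv.conj_apply, LinearEquiv.eq_comp_toLinearMap_symm]
    apply LinearMap.ext
    rintro ⟨f, g⟩
    change d (LinearMap.adjoint d (A₁ f + S₁ g)) =
      A₁ (a (LinearMap.adjoint a f)) + S₁ (b (LinearMap.adjoint b g))
    rw [map_add, map_add, hA', hS', hA, hS]
  unfold spec
  rw [hconj, LinearEquiv.charpoly_conj, LinearMap.charpoly_prodMap, Polynomial.roots_mul]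
  exact mul_ne_zero (LinearMap.charpoly_monic _).ne_zero (LinearMap.charpoly_monic _).ne_zero

end Linear

/-! ### Graph coverings as derived graphs -/

/-- A graph covering with fibres of size `k` is a derived graph. -/
lemma exists_derivedGraph_iso {X Y : Type*} {A : SimpleGraph X} {B : SimpleGraph Y} {k : ℕ}
    (p : Y → X) (hom : ∀ {y z}, B.Adj y z → A.Adj (p y) (p z))
    (lift : ∀ y x, A.Adj (p y) x → ∃ z, p z = x ∧ B.Adj y z)
    (lift_unique : ∀ {y z z'}, B.Adj y z → B.Adj y z' → p z = p z' → z = z')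
    (fibre : ∀ x, Nonempty (Fin k ≃ {y // p y = x})) :
    ∃ (ψ : VoltageAssignment A k) (η : derivedGraph ψ ≃g B), ∀ x a, p (η (x, a)) = x := by
  have e : ∀ x, Fin k ≃ {y // p y = x} := fun x => (fibre x).some
  have hp : ∀ x a, p (e x a) = x := fun x a => (e x a).2
  -- The voltage on `(x, x')` sends the label `b` over `x'` to the label of the neighbour over `x`,
  -- as the convention `a = ψ(u, v)(b)` requires.
  have key : ∀ (x x' : X), A.Adj x x' → ∀ b, ∃ a, B.Adj (e x a).1 (e x' b).1 := by
    intro x x' h b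
    obtain ⟨z, hz, hadj⟩ := lift (e x' b).1 x (by rw [hp]; exact h.symm)
    refine ⟨(e x).symm ⟨z, hz⟩, ?_⟩
    rw [Equiv.apply_symm_apply]
    exact hadj.symm
  choose r hr using key
  have hr_eq : ∀ {x x'} (h : A.Adj x x') {a b}, B.Adj (e x a).1 (e x' b).1 → a = r x x' h b := by
    intro x x' h a b hab
    apply (e x).injective
    exact Subtype.ext (lift_unique hab.symm (hr x x' h b).symm (by rw [hp, hp]))
  let ψ : VoltageAssignment A k :=
    { val := fun d =>
        { toFun := r d.fst d.snd d.adj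
          invFun := r d.snd d.fst d.adj.symm
          left_inv := fun b => (hr_eq _ (hr _ _ d.adj b).symm).symm
          right_inv := fun b => (hr_eq _ (hr _ _ d.adj.symm b).symm).symm }
      val_symm := fun d => rfl }
  let η : X × Fin k ≃ Y :=
    { toFun := fun q => (e q.1 q.2).1
      invFun := fun y => (p y, (e (p y)).symm ⟨y, rfl⟩)
      left_inv := by
        rintro ⟨x, a⟩
        -- The base point is generalised so that the equality `p (e x a) = x` can be substituted in
        -- the dependent second component.
        have : ∀ (x' : X) (h : p (e x a).1 = x'), (x', (e x').symm ⟨(e x a).1, h⟩) = (x, a) := by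
          intro x' h
          obtain rfl : x = x' := (hp x a).symm.trans h
          rw [Prod.mk.injEq]
          exact ⟨rfl, (e x).symm_apply_apply a⟩
        exact this _ rfl
      right_inv := fun y => by simp }
  refine ⟨ψ, ⟨η, ?_⟩, fun x a => hp x a⟩
  rintro ⟨x, a⟩ ⟨x', b⟩
  constructor
  · intro h
    have hxx : A.Adj x x' := by
      have := hom h
      rwa [show p (η (x, a)) = x from hp x a, show p (η (x', b)) = x' from hp x' b] at this
    exact ⟨hxx, hr_eq hxx h⟩
  · rintro ⟨h, h'⟩
    change B.Adj (e x a).1 (e x' b).1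
    rw [show a = r x x' h b from h']
    exact hr x x' h b

/-! ### Faces and ordered faces under a covering -/

section Projection

variable {V W : Type*} [DecidableEq V] [DecidableEq W] {K : SimpComplex V} {M : SimpComplex W}
  {φ : V → W}

namespace IsCovering

lemma injOn (h : IsCovering φ K M) {F : Finset V} (hF : F ∈ K.faces) : Set.InjOn φ F :=
  (h.bijOn _ (h.simplicial F hF) F ⟨hF, rfl⟩).injOn

lemma card_image (h : IsCovering φ K M) {F : Finset V} (hF : F ∈ K.faces) :
    (F.image φ).card = F.card :=
  Finset.card_image_of_injOn (h.injOn hF)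

/-- The simplex of `M` under a simplex of `K`. -/
def face (h : IsCovering φ K M) {n : ℕ} (F : K.Face n) : M.Face n :=
  ⟨⟨F.1.1.image φ, h.simplicial _ F.1.2⟩, (h.card_image F.1.2).trans F.2⟩

/-- The ordered simplex of `M` under an ordered simplex of `K`. -/
def ordFace (h : IsCovering φ K M) {n : ℕ} (v : OrdFace K n) : OrdFace M n :=
  ⟨⟨fun j => φ (v.1 j), fun a b hab => v.1.injective
      (h.injOn v.2 (by simp) (by simp) hab)⟩, by
    have : Finset.univ.map ⟨fun j => φ (v.1 j), fun a b hab => v.1.injective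
        (h.injOn v.2 (by simp) (by simp) hab)⟩ = (Finset.univ.map v.1).image φ := by
      ext x; simp; rfl
    rw [this]
    exact h.simplicial _ v.2⟩

lemma simplex_ordFace (h : IsCovering φ K M) {n : ℕ} (v : OrdFace K n) :
    (h.ordFace v).simplex.1 = v.simplex.1.image φ := by
  ext x; simp [ordFace, OrdFace.simplex]; rfl

lemma ordFace_perm (h : IsCovering φ K M) {n : ℕ} (v : OrdFace K n) (σ : Equiv.Perm (Fin n)) :
    h.ordFace (v.perm σ) = (h.ordFace v).perm σ := rfl

lemma ordFace_del (h : IsCovering φ K M) {n : ℕ} (v : OrdFace K (n + 1)) (j : Fin (n + 1)) :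
    h.ordFace (v.del j) = (h.ordFace v).del j := rfl

lemma eq_of_ordFace_eq (h : IsCovering φ K M) {n : ℕ} {u v : OrdFace K n}
    (hs : u.simplex = v.simplex) (he : h.ordFace u = h.ordFace v) : u = v := by
  have hm : ∀ j, u.1 j ∈ v.simplex.1 := fun j => by
    rw [← hs]; simp [OrdFace.simplex]
  apply Subtype.ext
  ext j
  refine h.injOn v.simplex.2 (hm j) (by simp [OrdFace.simplex]) ?_
  exact congrArg (fun w : OrdFace M n => w.1 j) he

end IsCovering

omit [DecidableEq V] in
lemma OrdFace.card_simplex {n : ℕ} (v : OrdFace K n) : v.simplex.1.card = n := by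
  simp [OrdFace.simplex]

/-- The simplex underlying an ordered simplex, with its number of vertices. -/
def OrdFace.toFace {n : ℕ} (v : OrdFace K n) : K.Face n := ⟨v.simplex, v.card_simplex⟩

omit [DecidableEq V] in
lemma toFace_ordering {n : ℕ} (F : K.Face n) : (ordering F).toFace = F :=
  Subtype.ext (simplex_ordering F)

omit [DecidableEq V] in
lemma OrdFace.toFace_perm {n : ℕ} (v : OrdFace K n) (σ : Equiv.Perm (Fin n)) :
    (v.perm σ).toFace = v.toFace := Subtype.ext (v.simplex_perm σ)

omit [DecidableEq V] in
lemma OrdFace.isFacetOf_del {n : ℕ} (v : OrdFace K (n + 1)) (j : Fin (n + 1)) :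
    IsFacetOf (v.del j).simplex.1 v.simplex.1 := by
  refine ⟨?_, by rw [OrdFace.card_simplex, OrdFace.card_simplex]⟩
  change Finset.univ.map ((Fin.succAboveEmb j).trans v.1) ⊆ Finset.univ.map v.1
  rw [← Finset.map_map]
  exact Finset.map_subset_map.2 (Finset.subset_univ _)

lemma IsCovering.toFace_ordFace (h : IsCovering φ K M) {n : ℕ} (v : OrdFace K n) :
    (h.ordFace v).toFace = h.face v.toFace :=
  Subtype.ext (Subtype.ext (h.simplex_ordFace v))

/-! ### Pulling back cochains -/

variable {n k : ℕ}

/-- The pullback of a cochain, multiplied by `c a` on the `a`-th sheet. -/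
noncomputable def pullback (h : IsCovering φ K M) (wK : Weight K) (wM : Weight M)
    (e : M.Face n × Fin k ≃ K.Face n) (c : Fin k → ℝ) : Cochain M wM n →ₗ[ℝ] Cochain K wK n where
  toFun f := Cochain.mk (fun v => c (e.symm v.toFace).2 * f.eval (h.ordFace v)) (by
    intro v σ
    rw [OrdFace.toFace_perm, h.ordFace_perm, Cochain.eval_perm]; ring)
  map_add' f g := Cochain.ext_eval fun v => by simp [mul_add]
  map_smul' a f := Cochain.ext_eval fun v => by simp; ring

@[simp] lemma eval_pullback (h : IsCovering φ K M) (wK : Weight K) (wM : Weight M)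
    (e : M.Face n × Fin k ≃ K.Face n) (c : Fin k → ℝ) (f : Cochain M wM n) (v : OrdFace K n) :
    (pullback h wK wM e c f).eval v = c (e.symm v.toFace).2 * f.eval (h.ordFace v) := rfl

omit [DecidableEq V] in
lemma inner_cochain [Fintype V] {w : Weight K} (f g : Cochain K w n) :
    inner ℝ f g = ∑ F : K.Face n, w.val F.1 * f.eval (ordering F) * g.eval (ordering F) := rfl

/-- The faces of `K` are pairs of a face of `M` and a sheet, and the weight does not see the sheet,
so the sum factors. The reference orderings in `K` need not project to those in `M`; a product of
two cochains ignores the difference. -/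
lemma inner_pullback [Fintype V] [Fintype W] (h : IsCovering φ K M) {wK : Weight K} {wM : Weight M}
    {e : M.Face n × Fin k ≃ K.Face n} (he : ∀ x, h.face (e x) = x.1)
    (hw : ∀ F : K.Face n, wK.val F.1 = wM.val (h.face F).1) (c d : Fin k → ℝ)
    (f g : Cochain M wM n) :
    inner ℝ (pullback h wK wM e c f) (pullback h wK wM e d g) =
      (∑ a, c a * d a) * inner ℝ f g := by
  rw [inner_cochain, inner_cochain, ← e.sum_comp, Fintype.sum_prod_type, Finset.mul_sum]
  refine Finset.sum_congr rfl fun G _ => ?_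
  rw [Finset.sum_mul]
  refine Finset.sum_congr rfl fun a _ => ?_
  have hs : (h.ordFace (ordering (e (G, a)))).simplex = (ordering G).simplex := by
    have := h.toFace_ordFace (ordering (e (G, a)))
    rw [toFace_ordering, he] at this
    rw [simplex_ordering]
    exact congrArg Subtype.val this
  have hm := Cochain.eval_mul_eval_eq f g hs
  rw [eval_pullback, eval_pullback, toFace_ordering, e.symm_apply_apply, hw, he]
  linear_combination c a * d a * wM.val G.1 * hm

/-- Deleting a vertex commutes with projection, so the terms match one by one, and the change of `c`
between a face and its facet is exactly the factor `s`. -/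
lemma coboundaryWith_pullback (h : IsCovering φ K M) {wK : Weight K} {wM : Weight M}
    {e₀ : M.Face n × Fin k ≃ K.Face n} {e₁ : M.Face (n + 1) × Fin k ≃ K.Face (n + 1)}
    {s : M.Simplex → M.Simplex → ℝ} {c : Fin k → ℝ}
    (hs : ∀ (F : K.Face n) (F' : K.Face (n + 1)), IsFacetOf F.1.1 F'.1.1 →
      c (e₀.symm F).2 = c (e₁.symm F').2 * s (h.face F).1 (h.face F').1)
    (f : Cochain M wM n) :
    coboundary K wK n (pullback h wK wM e₀ c f) =
      pullback h wK wM e₁ c (coboundaryWith wM s n f) := by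
  apply Cochain.ext_eval
  intro v
  rw [eval_pullback]
  change ∑ j : Fin (n + 1), (-1 : ℝ) ^ (j : ℕ) * 1 * (pullback h wK wM e₀ c f).eval (v.del j) =
    _ * ∑ j : Fin (n + 1), (-1) ^ (j : ℕ) * s ((h.ordFace v).del j).simplex (h.ordFace v).simplex
      * f.eval ((h.ordFace v).del j)
  rw [Finset.mul_sum]
  refine Finset.sum_congr rfl fun j _ => ?_
  have h1 := hs (v.del j).toFace v.toFace (v.isFacetOf_del j)
  rw [← h.toFace_ordFace, ← h.toFace_ordFace, h.ordFace_del] at h1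
  change _ = _ * s ((h.ordFace v).del j).simplex (h.ordFace v).simplex at h1
  rw [eval_pullback, h.ordFace_del, h1]
  ring

/-- The character of a two-sheeted covering: `1` on the sheet `0` and `-1` on the sheet `1`. -/
def sheetSign (a : Fin 2) : ℤ := if a = 0 then 1 else -1

/-- This is why signs of permutations suffice for two sheets: the vector `(1, -1)` spans the sign
representation inside the permutation representation. -/
lemma sheetSign_perm : ∀ (σ : Equiv.Perm (Fin 2)) (b : Fin 2),
    sheetSign (σ b) = sheetSign b * (Equiv.Perm.sign σ : ℤ) := by decide

/-- Orthogonality of the two characters: half of the left side is the indicator of being on the same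
sheet. -/
lemma sheetSign_mul : ∀ a b, 1 + sheetSign a * sheetSign b = if a = b then 2 else 0 := by decide

/-- Summing a cochain of `K` over the lifts of an ordered simplex, with coefficients `c`. -/
noncomputable def pushforward [Fintype V] (h : IsCovering φ K M) {wK : Weight K} (wM : Weight M)
    (c : K.Face n → ℝ) (f : Cochain K wK n) : Cochain M wM n :=
  Cochain.mk (fun u => ∑ v : OrdFace K n with h.ordFace v = u, c v.toFace * f.eval v) (by
    intro u σ
    rw [Finset.mul_sum]
    -- Reordering by `σ` carries the lifts of `u` bijectively to the lifts of `u.perm σ`.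
    refine (Finset.sum_bij' (fun v _ => v.perm σ) (fun v _ => v.perm σ⁻¹) ?_ ?_ ?_ ?_ ?_).symm
    · intro v hv
      simp only [Finset.mem_filter, Finset.mem_univ, true_and] at hv ⊢
      rw [h.ordFace_perm, hv]
    · intro v hv
      simp only [Finset.mem_filter, Finset.mem_univ, true_and] at hv ⊢
      rw [h.ordFace_perm, hv]
      apply Subtype.ext; ext j
      simp [OrdFace.perm]
    · intro v _
      apply Subtype.ext; ext j
      simp [OrdFace.perm]
    · intro v _
      apply Subtype.ext; ext j
      simp [OrdFace.perm]
    · intro v _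
      rw [OrdFace.toFace_perm, Cochain.eval_perm]; ring)

/-- A cochain is its average over the sheets plus a part that changes sign between them. At `v`, a
lift `u` of the same ordered face enters with coefficient `(1 + ε(v) ε(u)) / 2`, which is `1` for `u
= v` and `0` otherwise. -/
lemma exists_pullback_add_pullback [Fintype V] (h : IsCovering φ K M) {wK : Weight K}
    {wM : Weight M} {e : M.Face n × Fin 2 ≃ K.Face n} (he : ∀ x, h.face (e x) = x.1)
    (f : Cochain K wK n) :
    ∃ g g', pullback h wK wM e 1 g + pullback h wK wM e (fun a => sheetSign a) g' = f := by
  refine ⟨pushforward h wM (fun _ => 1 / 2) f,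
    pushforward h wM (fun F => sheetSign (e.symm F).2 / 2) f, Cochain.ext_eval fun v => ?_⟩
  rw [Cochain.eval_add, eval_pullback, eval_pullback]
  simp only [pushforward, Cochain.eval_mk, Pi.one_apply, one_mul]
  rw [Finset.mul_sum, ← Finset.sum_add_distrib, Finset.sum_eq_single v]
  · have := sheetSign_mul (e.symm v.toFace).2 (e.symm v.toFace).2
    rw [if_pos rfl] at this
    have h2 : (1 : ℝ) + sheetSign (e.symm v.toFace).2 * sheetSign (e.symm v.toFace).2 = 2 := by
      exact_mod_cast this
    linear_combination f.eval v / 2 * h2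
  · intro u hu huv
    rw [Finset.mem_filter] at hu
    -- Two lifts on the same sheet have the same underlying face, and injectivity of `φ` on it
    -- forces the same ordering.
    have hne : (e.symm v.toFace).2 ≠ (e.symm u.toFace).2 := by
      intro ha
      have hG : (e.symm v.toFace).1 = (e.symm u.toFace).1 := by
        rw [← he, ← he, e.apply_symm_apply, e.apply_symm_apply, ← h.toFace_ordFace,
          ← h.toFace_ordFace, hu.2]
      have hF : u.toFace = v.toFace := (e.symm.injective (Prod.ext hG ha)).symm
      exact huv (h.eq_of_ordFace_eq (congrArg Subtype.val hF) hu.2)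
    have := sheetSign_mul (e.symm v.toFace).2 (e.symm u.toFace).2
    rw [if_neg hne] at this
    have h2 : (1 : ℝ) + sheetSign (e.symm v.toFace).2 * sheetSign (e.symm u.toFace).2 = 0 := by
      exact_mod_cast this
    linear_combination f.eval u / 2 * h2
  · simp

/-- The spectrum of the down Laplacian of a two-sheeted covering, when the faces over `S_{n-1}(M)`
and `S_n(M)` are labelled by sheets and `s` records whether incident faces are on the same sheet. -/
lemma spec_downLaplacian_eq_add [Fintype V] [Fintype W] (h : IsCovering φ K M) {wK : Weight K}
    {wM : Weight M} {e₀ : M.Face n × Fin 2 ≃ K.Face n} {e₁ : M.Face (n + 1) × Fin 2 ≃ K.Face (n + 1)}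
    (he₀ : ∀ x, h.face (e₀ x) = x.1) (he₁ : ∀ x, h.face (e₁ x) = x.1)
    (hw₀ : ∀ F : K.Face n, wK.val F.1 = wM.val (h.face F).1)
    (hw₁ : ∀ F : K.Face (n + 1), wK.val F.1 = wM.val (h.face F).1) {s : IncidenceSign M}
    (hs : ∀ (F : K.Face n) (F' : K.Face (n + 1)), IsFacetOf F.1.1 F'.1.1 →
      sheetSign (e₀.symm F).2 = sheetSign (e₁.symm F').2 * s.val (h.face F).1 (h.face F').1) :
    spec (downLaplacian K wK n) =
      spec (downLaplacian M wM n) + spec (signedDownLaplacian M wM s n) := by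
  have hone : ∑ a : Fin 2, (1 : Fin 2 → ℝ) a * (1 : Fin 2 → ℝ) a = 2 := by simp
  have hmix : ∑ a : Fin 2, (sheetSign a : ℝ) * (1 : Fin 2 → ℝ) a = 0 := by simp [sheetSign]
  have hsgn : ∑ a : Fin 2, (sheetSign a : ℝ) * (sheetSign a : ℝ) = 2 := by
    simp [sheetSign]; norm_num
  -- The scale `2` is the number of sheets; the unsigned coboundary of `M` is the case of constant
  -- coefficients `1`.
  refine spec_comp_adjoint_eq_add (c := 2) two_ne_zero
    (A₀ := pullback h wK wM e₀ 1) (A₁ := pullback h wK wM e₁ 1)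
    (S₀ := pullback h wK wM e₀ fun a => sheetSign a)
    (S₁ := pullback h wK wM e₁ fun a => sheetSign a)
    (coboundaryWith_pullback h fun F F' _ => by simp)
    (coboundaryWith_pullback h fun F F' hF => by exact_mod_cast hs F F' hF)
    (fun f g => by rw [inner_pullback h he₀ hw₀, hone])
    (fun f g => by rw [inner_pullback h he₀ hw₀, hmix, zero_mul])
    (fun f g => by rw [inner_pullback h he₀ hw₀, hsgn])
    (fun f g => by rw [inner_pullback h he₁ hw₁, hone])
    (fun f g => by rw [inner_pullback h he₁ hw₁, hmix, zero_mul])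
    (fun f g => by rw [inner_pullback h he₁ hw₁, hsgn])
    (exists_pullback_add_pullback h he₀) (exists_pullback_add_pullback h he₁)

/-! ### The incidence graph of a covering -/

namespace IsCovering

/-- The map of incidence graphs under a covering. -/
def node (h : IsCovering φ K M) : K.Face n ⊕ K.Face (n + 1) → M.Face n ⊕ M.Face (n + 1) :=
  Sum.map h.face h.face

lemma isFacetOf_face (h : IsCovering φ K M) {F : K.Face n} {F' : K.Face (n + 1)}
    (hF : IsFacetOf F.1.1 F'.1.1) : IsFacetOf (h.face F).1.1 (h.face F').1.1 :=
  ⟨Finset.image_subset_image hF.1, by rw [(h.face F).2, (h.face F').2]⟩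

lemma node_adj (h : IsCovering φ K M) {x y : K.Face n ⊕ K.Face (n + 1)}
    (hxy : (incidenceGraph K n).Adj x y) : (incidenceGraph M n).Adj (h.node x) (h.node y) := by
  rcases x with F | F <;> rcases y with F' | F'
  · exact hxy.elim
  · exact h.isFacetOf_face hxy
  · exact h.isFacetOf_face hxy
  · exact hxy.elim

/-- A face has only one face over a given simplex. -/
lemma eq_of_subset (h : IsCovering φ K M) {E E' F : Finset V} (hF : F ∈ K.faces) (hE : E ⊆ F)
    (hE' : E' ⊆ F) (heq : E.image φ = E'.image φ) : E = E' := by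
  have : ∀ {A B : Finset V}, A ⊆ F → B ⊆ F → A.image φ = B.image φ → A ⊆ B := by
    intro A B hA hB hAB x hx
    have : φ x ∈ B.image φ := hAB ▸ Finset.mem_image_of_mem φ hx
    obtain ⟨y, hy, hyx⟩ := Finset.mem_image.1 this
    rwa [← h.injOn hF (hB hy) (hA hx) hyx]
  exact (this hE hE' heq).antisymm (this hE' hE heq.symm)

/-- A nonempty face is in only one face over a given simplex. -/
lemma eq_of_superset (h : IsCovering φ K M) {E F F' : Finset V} (hne : E.Nonempty)
    (hF : F ∈ K.faces) (hF' : F' ∈ K.faces) (hE : E ⊆ F) (hE' : E ⊆ F')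
    (heq : F.image φ = F'.image φ) : F = F' := by
  by_contra hFF
  have := h.pairwise_disjoint _ (h.simplicial F hF) ⟨hF, rfl⟩ ⟨hF', heq.symm⟩ hFF
  obtain ⟨x, hx⟩ := hne
  exact Finset.disjoint_left.1 this (hE hx) (hE' hx)

/-- The bound on `n` makes the lower face nonempty, so that two cofaces of it with the same image
would meet; the empty simplex lies in all vertices over a given one. -/
lemma node_unique (h : IsCovering φ K M) (hn : 1 ≤ n) {x y z : K.Face n ⊕ K.Face (n + 1)}
    (hy : (incidenceGraph K n).Adj x y) (hz : (incidenceGraph K n).Adj x z)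
    (hyz : h.node y = h.node z) : y = z := by
  have hsub : ∀ {m : ℕ} {F G : K.Face m}, F.1.1 = G.1.1 → F = G := fun e =>
    Subtype.ext (Subtype.ext e)
  have himg : ∀ {m : ℕ} {F G : K.Face m}, h.face F = h.face G → F.1.1.image φ = G.1.1.image φ :=
    fun e => congrArg (fun x => x.1.1) e
  rcases x with E | E
  · rcases y with F | F
    · exact hy.elim
    rcases z with F' | F'
    · exact hz.elim
    refine congrArg Sum.inr (hsub (h.eq_of_superset ?_ F.1.2 F'.1.2 hy.1 hz.1
      (himg (Sum.inr_injective hyz))))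
    exact Finset.card_pos.1 (by rw [E.2]; exact hn)
  · rcases y with F | F
    swap
    · exact hy.elim
    rcases z with F' | F'
    swap
    · exact hz.elim
    exact congrArg Sum.inl (hsub (h.eq_of_subset E.1.2 hy.1 hz.1 (himg (Sum.inl_injective hyz))))

end IsCovering

/-- Only lifting from a face to a coface needs the strong covering axiom; a facet of the image is
already covered by a subset of the face. -/
lemma IsStrongCovering.exists_node (h : IsStrongCovering φ K M) (x : K.Face n ⊕ K.Face (n + 1))
    (y : M.Face n ⊕ M.Face (n + 1)) (hxy : (incidenceGraph M n).Adj (h.toIsCovering.node x) y) :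
    ∃ z, h.toIsCovering.node z = y ∧ (incidenceGraph K n).Adj x z := by
  rcases x with F | F <;> rcases y with G | G
  · exact hxy.elim
  · obtain ⟨F', ⟨hF', hFG⟩, hFF'⟩ := h.lift_incidence _ (h.toIsCovering.face F).1.2 _ G.1.2 hxy
      F.1.1 ⟨F.1.2, rfl⟩
    refine ⟨.inr ⟨⟨F', hF'⟩, hFF'.2.trans (by rw [F.2])⟩, ?_, hFF'⟩
    exact congrArg Sum.inr (Subtype.ext (Subtype.ext hFG))
  · have hxy' : IsFacetOf G.1.1 (F.1.1.image φ) := hxy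
    -- The lift of `G` inside `F` consists of the vertices of `F` over `G`.
    have himg : (F.1.1.filter fun v => φ v ∈ G.1.1).image φ = G.1.1 := by
      ext w
      simp only [Finset.mem_image, Finset.mem_filter]
      constructor
      · rintro ⟨v, ⟨_, hv⟩, rfl⟩
        exact hv
      · intro hw
        obtain ⟨v, hv, rfl⟩ := Finset.mem_image.1 (hxy'.1 hw)
        exact ⟨v, ⟨hv, hw⟩, rfl⟩
    have hmem := K.down_closed _ F.1.2 _ (Finset.filter_subset (fun v => φ v ∈ G.1.1) F.1.1)
    have hcard : (F.1.1.filter fun v => φ v ∈ G.1.1).card = n := by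
      rw [← h.toIsCovering.card_image hmem, himg, G.2]
    refine ⟨.inl ⟨⟨_, hmem⟩, hcard⟩, ?_, Finset.filter_subset _ _, ?_⟩
    · exact congrArg Sum.inl (Subtype.ext (Subtype.ext himg))
    · rw [F.2, hcard]
  · exact hxy.elim

/-- The faces with `n` vertices over `G` are the simplices over `G`. -/
def IsCovering.faceFibreEquiv (h : IsCovering φ K M) (G : M.Face n) :
    lifts φ K G.1.1 ≃ {F : K.Face n // h.face F = G} where
  toFun F := ⟨⟨⟨F.1, F.2.1⟩, by
    rw [← h.card_image F.2.1, F.2.2, G.2]⟩, Subtype.ext (Subtype.ext F.2.2)⟩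
  invFun F := ⟨F.1.1.1, F.1.1.2, congrArg (fun x => x.1.1) F.2⟩
  left_inv _ := rfl
  right_inv _ := rfl

/-- The degree is written `k + 1` because `Set.ncard` is `0` on infinite sets: a nonzero value
certifies finiteness. -/
lemma IsFoldCovering.nonempty_equiv_lifts (h : IsFoldCovering (k + 1) φ K M) {G : Finset W}
    (hG : G ∈ M.faces) (hne : G.Nonempty) : Nonempty (Fin (k + 1) ≃ lifts φ K G) := by
  have hc : Nat.card (lifts φ K G) = k + 1 := h.degree G hG hne
  have : Finite (lifts φ K G) := Nat.finite_of_card_ne_zero (by omega)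
  exact ⟨(Finite.equivFinOfCardEq hc).symm⟩

/-- The bound on `n` excludes the empty simplex, to which the degree condition does not apply. -/
lemma IsFoldCovering.nonempty_equiv_node (h : IsFoldCovering (k + 1) φ K M) (hn : 1 ≤ n)
    (x : M.Face n ⊕ M.Face (n + 1)) :
    Nonempty (Fin (k + 1) ≃ {y // h.toIsCovering.node y = x}) := by
  rcases x with G | G
  · obtain ⟨e⟩ := h.nonempty_equiv_lifts G.1.2 (Finset.card_pos.1 (by rw [G.2]; exact hn))
    refine ⟨(e.trans (h.toIsCovering.faceFibreEquiv G)).trans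
      (Equiv.ofBijective (fun F => ⟨.inl F.1, congrArg Sum.inl F.2⟩) ⟨?_, ?_⟩)⟩
    · intro F F' hF
      exact Subtype.ext (Sum.inl_injective (congrArg Subtype.val hF))
    · rintro ⟨F | F, hF⟩
      · exact ⟨⟨F, Sum.inl_injective hF⟩, rfl⟩
      · exact (Sum.inr_ne_inl hF).elim
  · obtain ⟨e⟩ := h.nonempty_equiv_lifts G.1.2 (Finset.card_pos.1 (by rw [G.2]; omega))
    refine ⟨(e.trans (h.toIsCovering.faceFibreEquiv G)).trans
      (Equiv.ofBijective (fun F => ⟨.inr F.1, congrArg Sum.inr F.2⟩) ⟨?_, ?_⟩)⟩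
    · intro F F' hF
      exact Subtype.ext (Sum.inr_injective (congrArg Subtype.val hF))
    · rintro ⟨F | F, hF⟩
      · exact (Sum.inl_ne_inr hF).elim
      · exact ⟨⟨F, Sum.inr_injective hF⟩, rfl⟩

lemma IsCovering.simplex_node (h : IsCovering φ K M) (x : K.Face n ⊕ K.Face (n + 1)) :
    (incidenceGraphSimplex (h.node x)).1 = (incidenceGraphSimplex x).1.image φ := by
  rcases x with F | F <;> rfl

-- The number of vertices tells the two summands apart.
omit [DecidableEq V] in
lemma incidenceGraphSimplex_injective :
    Function.Injective (incidenceGraphSimplex (K := K) (n := n)) := by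
  rintro (F | F) (F' | F') h
  · exact congrArg Sum.inl (Subtype.ext h)
  · have := F.2; have := F'.2; have : F.1 = F'.1 := h
    simp_all
  · have := F.2; have := F'.2; have : F.1 = F'.1 := h
    simp_all
  · exact congrArg Sum.inr (Subtype.ext h)

lemma isCompatible_iff (h : IsCovering φ K M) {ψ : VoltageAssignment (incidenceGraph M n) k}
    {η : derivedGraph ψ ≃g incidenceGraph K n} :
    IsCompatible φ η ↔ ∀ x a, h.node (η (x, a)) = x := by
  refine forall₂_congr fun x a => ?_
  rw [← h.simplex_node, ← incidenceGraphSimplex_injective.eq_iff, Subtype.ext_iff]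

/-! ### Sheet labels and signs from the derived graph -/

/-- A bijection between sums that splits over the summands restricts to the left summands. -/
lemma exists_equiv_inl {X X' Y Y' A : Type*} (p : Y → X) (p' : Y' → X')
    (e : (X ⊕ X') × A ≃ Y ⊕ Y') (he : ∀ x a, Sum.map p p' (e (x, a)) = x) :
    ∃ e₀ : X × A ≃ Y, (∀ x, p (e₀ x) = x.1) ∧ ∀ x a, e (.inl x, a) = .inl (e₀ (x, a)) := by
  have key : ∀ q : X × A, ∃ y, e (.inl q.1, q.2) = .inl y := by
    rintro ⟨x, a⟩
    have h := he (.inl x) a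
    rcases hy : e (.inl x, a) with y | y
    · exact ⟨y, rfl⟩
    · rw [hy] at h; exact (Sum.inr_ne_inl h).elim
  choose f hf using key
  refine ⟨Equiv.ofBijective f ⟨?_, ?_⟩, ?_, fun x a => hf (x, a)⟩
  · rintro ⟨x, a⟩ ⟨x', a'⟩ h
    have := e.injective ((hf (x, a)).trans ((congrArg Sum.inl h).trans (hf (x', a')).symm))
    simpa using this
  · intro y
    obtain ⟨⟨x, a⟩, hx⟩ := e.surjective (.inl y)
    have h := he x a
    rw [hx] at h
    obtain rfl : Sum.inl (p y) = x := h
    exact ⟨(p y, a), Sum.inl_injective ((hf (p y, a)).symm.trans hx)⟩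
  · rintro ⟨x, a⟩
    have h := he (.inl x) a
    rw [hf (x, a)] at h
    exact Sum.inl_injective h

omit [DecidableEq W] in
/-- The incidence signing given by the signs of a voltage assignment. -/
lemma exists_isSignOf (ψ : VoltageAssignment (incidenceGraph M n) k) :
    ∃ s : IncidenceSign M, IsSignOf s ψ := by
  classical
  -- Incidences in other dimensions are not arcs of the graph; they get the arbitrary sign `1`.
  refine ⟨{ val := fun F F' => if h : IsFacetOf F.1 F'.1 then
              (if hc : F.1.card = n then (Equiv.Perm.sign (ψ.val ⟨(.inl ⟨F, hc⟩,
                .inr ⟨F', by rw [h.2, hc]⟩), h⟩) : ℤ) else 1) else 0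
            of_incident := ?_
            of_not_incident := fun F F' h => dif_neg h }, ?_⟩
  · intro F F' h
    rw [dif_pos h]
    split_ifs with hc
    · rcases Int.units_eq_one_or (Equiv.Perm.sign (ψ.val ⟨(.inl ⟨F, hc⟩,
        .inr ⟨F', by rw [h.2, hc]⟩), h⟩)) with h' | h' <;> rw [h'] <;> simp
    · exact Or.inl rfl
  · intro F F' h
    have hf : IsFacetOf F.1.1 F'.1.1 := h
    change (if h : IsFacetOf F.1.1 F'.1.1 then _ else _) = _
    rw [dif_pos hf, dif_pos F.2]

end Projection

end CoverLap

/-! ### The main theorem -/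

open CoverLap
theorem mainTheorem7 {V W : Type*} [Fintype V] [Fintype W] [DecidableEq V] [DecidableEq W]
    (K : SimpComplex V) (M : SimpComplex W) (φ : V → W) (hφ : IsFoldCovering 2 φ K M)
    (wK : Weight K) (wM : Weight M) (i : ℕ) (hi : 1 ≤ i)
    (hw : ∀ (F : K.Simplex) (G : M.Simplex), F.1.card = i ∨ F.1.card = i + 1 →
      F.1.image φ = G.1 → wK.val F = wM.val G) :
    (∃ (ψ : VoltageAssignment (incidenceGraph M i) 2)
      (η : derivedGraph ψ ≃g incidenceGraph K i), IsCompatible φ η) ∧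
    ∀ (ψ : VoltageAssignment (incidenceGraph M i) 2)
      (η : derivedGraph ψ ≃g incidenceGraph K i), IsCompatible φ η →
      (∃ s : IncidenceSign M, IsSignOf s ψ) ∧
      ∀ s : IncidenceSign M, IsSignOf s ψ →
        spec (downLaplacian K wK i) =
          spec (downLaplacian M wM i) + spec (signedDownLaplacian M wM s i) := by
  have h : IsCovering φ K M := hφ.toIsCovering
  constructor
  · obtain ⟨ψ, η, hη⟩ := exists_derivedGraph_iso (A := incidenceGraph M i) h.node h.node_adj
      hφ.toIsStrongCovering.exists_node (h.node_unique hi) (hφ.nonempty_equiv_node hi)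
    exact ⟨ψ, η, (isCompatible_iff h).2 hη⟩
  · intro ψ η hη
    refine ⟨exists_isSignOf ψ, fun s hs => ?_⟩
    rw [isCompatible_iff h] at hη
    obtain ⟨e₀, he₀, hη₀⟩ := exists_equiv_inl h.face h.face η.toEquiv hη
    -- The labelling of the larger faces comes from the same lemma after exchanging the summands on
    -- both sides.
    obtain ⟨e₁, he₁, hη₁⟩ := exists_equiv_inl h.face h.face
      (((Equiv.sumComm _ _).prodCongr (Equiv.refl _)).trans (η.toEquiv.trans (Equiv.sumComm _ _)))
      (fun x a => by
        have := congrArg Sum.swap (hη x.swap a)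
        rw [Sum.swap_swap] at this
        refine Eq.trans ?_ this
        change Sum.map h.face h.face (η (x.swap, a)).swap =
          (Sum.map h.face h.face (η (x.swap, a))).swap
        rcases η (x.swap, a) with y | y <;> rfl)
    have hη₁' : ∀ x a, η (.inr x, a) = .inr (e₁ (x, a)) := fun x a =>
      (Sum.swap_swap _).symm.trans (congrArg Sum.swap (hη₁ x a))
    refine spec_downLaplacian_eq_add h he₀ he₁ (fun F => hw _ _ (Or.inl F.2) rfl)
      (fun F => hw _ _ (Or.inr F.2) rfl) fun F F' hF => ?_
    obtain ⟨⟨G, a⟩, rfl⟩ := e₀.surjective F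
    obtain ⟨⟨G', b⟩, rfl⟩ := e₁.surjective F'
    have hadj : (incidenceGraph K i).Adj (η (.inl G, a)) (η (.inr G', b)) := by
      rw [hη₁', show η (.inl G, a) = .inl (e₀ (G, a)) from hη₀ G a]
      exact hF
    -- Since `η` reflects adjacency, incidence in `K` yields the voltage relation `a = ψ(G, G')(b)`,
    -- and applying `sheetSign` turns it into the sign rule for `s`.
    obtain ⟨hGG, hab⟩ := η.map_rel_iff.1 hadj
    rw [e₀.symm_apply_apply, e₁.symm_apply_apply, he₀, he₁, hs G G' hGG]
    change a = ψ.val _ b at hab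
    rw [hab, sheetSign_perm]
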